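/- Let $k$ be a field, let $R=k[x_0,\dots,x_N]$ be the homogeneous coordinate ring of $\mathbb{P}^N_k$, and let $\mathfrak m=(x_0,\dots,x_N)$. Let $1\le h\le \min\{n,N\}$ and let $F_1,\dots,F_n\in R$ be homogeneous polynomials such that any at most $h+1$ of them form a complete intersection, i.e. a regular sequence in $R$ (in any order); for $h<n$ this says that any $h+1$ of them do, and for $h=n$ that $F_1,\dots,F_n$ do. Let $$I=\bigcap_{1\le i_1<\dots<i_h\le n}(F_{i_1},\dots,F_{i_h})$$ be the defining ideal of the codimension $h$ star configuration in $\mathbb{P}^N_k$ given by $F_1,\dots,F_n$. For an integer $s\ge 0$ let $I^{(s)}=\bigcap_{\mathfrak p\in\operatorname{Ass}(R/I)}(I^sR_{\mathfrak p}\cap R)$ be the $s$-th symbolic power of $I$, and for a nonzero homogeneous ideal $J$ let $\alpha(J)$ be the least degree of a nonzero homogeneous polynomial in $J$. Then for all integers $m,r\ge 0$ $$I^{(r(m+h-1))}\subseteq \mathfrak m^{r(h-1)}\,\bigl(I^{(m)}\bigr)^r .$$ Moreover, the Demailly-like bound holds: for all integers $m,t\ge 1$ $$\frac{\alpha(I^{(t)})}{t}\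 \ge\ \frac{\alpha(I^{(m)})+h-1}{m+h-1}.$$ -/

import Mathlib

/-- The `n`-th symbolic power `I^(n) = ⋂_{𝔭 ∈ Ass(R/I)} (I^n R_𝔭 ∩ R)` of an ideal `I`. -/
noncomputable def symbolicPower {R : Type*} [CommRing R] (I : Ideal R) (n : ℕ) : Ideal R :=
  ⨅ p : associatedPrimes R (R ⧸ I),
    haveI : p.1.IsPrime := p.2.isPrime
    Ideal.comap (algebraMap R (Localization.AtPrime p.1))
      (Ideal.map (algebraMap R (Localization.AtPrime p.1)) (I ^ n))

/-- The least degree `α(I)` of a nonzero homogeneous polynomial in `I`. (By the convention for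
`sInf ∅` in `ℕ` the value is `0` when there is none, that is, for `I = 0` when `I` is homogeneous;
symbolic powers of ideals of star configurations are nonzero homogeneous ideals.) -/
noncomputable def initialDegree {σ k : Type*} [Field k] (I : Ideal (MvPolynomial σ k)) : ℕ :=
  sInf {d : ℕ | ∃ f ∈ I, f ≠ 0 ∧ f.IsHomogeneous d}

/-- The forms `F i`, `i ∈ S`, form a complete intersection: they are a regular sequence (this
includes that they generate a proper ideal). For forms of positive degree regularity does not
depend on the order; since a complete intersection is a property of the set of
forms, it is phrased for every enumeration `l` of `S`. -/
def IsCompleteIntersection {R : Type*} [CommRing R] {n : ℕ} (F : Fin n → R)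
    (S : Finset (Fin n)) : Prop :=
  ∀ l : List (Fin n), l.Nodup → (∀ i, i ∈ l ↔ i ∈ S) →
    RingTheory.Sequence.IsRegular R (l.map F)

/-- `F 0, …, F (n - 1)` are forms in the homogeneous coordinate ring `k[x_0, …, x_N]` of `ℙ^N`
giving a star configuration of codimension `h`, where `1 ≤ h ≤ min {n, N}`: any at most `h + 1` of
them form a complete intersection. (If `h < n`, this says that any `h + 1` of them do; if `h = n`,
it says that all the forms together do.) -/
structure IsStarConfiguration {k : Type*} [Field k] {N n : ℕ} (h : ℕ)
    (F : Fin n → MvPolynomial (Fin (N + 1)) k) : Prop where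
  one_le : 1 ≤ h
  le_card : h ≤ n
  le_dim : h ≤ N
  isHomogeneous : ∀ i, ∃ d, (F i).IsHomogeneous d
  isCompleteIntersection : ∀ S : Finset (Fin n), S.card ≤ h + 1 → IsCompleteIntersection F S

/-- The defining ideal of the codimension `h` star configuration given by `F`, the intersection
of the ideals `(F_{i_1}, …, F_{i_h})` over all `i_1 < ⋯ < i_h`. -/
noncomputable def starConfigurationIdeal {k : Type*} [Field k] {N n : ℕ} (h : ℕ)
    (F : Fin n → MvPolynomial (Fin (N + 1)) k) : Ideal (MvPolynomial (Fin (N + 1)) k) :=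
  ⨅ S ∈ {S : Finset (Fin n) | S.card = h}, Ideal.span (F '' (S : Set (Fin n)))

/-! ### Colon ideals of powers of regular elements, and intersections along a shelling. -/

section RegularPowers

variable {R : Type*} [CommRing R]

/-! The symbolic power `I^(s)` is generated by the monomials `∏ F i ^ a i` whose exponents sum to at
least `s` over every `h`-set (`symbolicPower_eq`). The containment thus becomes a statement about
exponent vectors: divide `a` by `r` with remainder and lower the quotient just enough that the
leftover factor has degree at least `r (h - 1)` in the forms (`exists_smul_le_of_le_sum`). The
Demailly-like bound follows by applying the containment to a power of a form of least degree.

For the description of `I^(s)`, only `h + 1` forms at a time are known to be regular, so the usual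
calculus of monomials in a regular sequence is not available for all `n` together. Instead one uses
the ideals `(F i ^ (e i + 1), i ∈ S)` with `|S| = h` and `∑ e i = s - 1`. A colon argument with
associated primes puts `I^(s)` inside each of them. In lexicographic order they are shellable, so
they can be intersected one at a time (`mem_span_monomials_of_shelling`), and each step needs only
the colon of a single such ideal by a monomial, which involves at most `h + 1` forms at once. -/

theorem mem_sup_span_singleton_iff {J : Ideal R} {a x : R} :
    x ∈ J ⊔ Ideal.span {a} ↔ ∃ j ∈ J, ∃ z, j + a * z = x := by
  rw [Submodule.mem_sup]
  constructor
  · rintro ⟨j, hj, w, hw, rfl⟩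
    obtain ⟨z, rfl⟩ := Ideal.mem_span_singleton.mp hw
    exact ⟨j, hj, z, rfl⟩
  · rintro ⟨j, hj, z, rfl⟩
    exact ⟨j, hj, _, Ideal.mem_span_singleton.mpr (dvd_mul_right a z), rfl⟩

/-- `y` and `a` nonzerodivisors modulo `J + (a)` and `J`: then `y` is one modulo `J + (a ^ b)`. -/
theorem mem_sup_span_pow_of_mul_mem {J : Ideal R} {a y : R} (ha : ∀ x, a * x ∈ J → x ∈ J)
    (hy : ∀ x, y * x ∈ J ⊔ Ideal.span {a} → x ∈ J ⊔ Ideal.span {a}) (b : ℕ) :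
    ∀ x, y * x ∈ J ⊔ Ideal.span {a ^ b} → x ∈ J ⊔ Ideal.span {a ^ b} := by
  induction b with
  | zero => intro x _; simp
  | succ b ih =>
    intro x hx
    have h1 : y * x ∈ J ⊔ Ideal.span {a} := by
      refine (sup_le_sup_left ?_ J) hx
      rw [Ideal.span_singleton_le_span_singleton]
      exact dvd_pow_self a (Nat.succ_ne_zero b)
    obtain ⟨j, hj, x', rfl⟩ := mem_sup_span_singleton_iff.mp (hy x h1)
    -- With `x = j + a * x'`, cancelling one factor `a` modulo `J` passes to `x'` and the exponent
    -- `b`.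
    obtain ⟨j₂, hj₂, z, hz⟩ := mem_sup_span_singleton_iff.mp hx
    have h2 : y * x' - a ^ b * z ∈ J := by
      apply ha
      have : a * (y * x' - a ^ b * z) = j₂ - y * j := by linear_combination -hz
      rw [this]
      exact J.sub_mem hj₂ (J.mul_mem_left _ hj)
    have h3 : y * x' ∈ J ⊔ Ideal.span {a ^ b} :=
      mem_sup_span_singleton_iff.mpr ⟨_, h2, z, by ring⟩
    obtain ⟨j₃, hj₃, w, hw⟩ := mem_sup_span_singleton_iff.mp (ih x' h3)
    exact mem_sup_span_singleton_iff.mpr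
      ⟨j + a * j₃, J.add_mem hj (J.mul_mem_left _ hj₃), w, by rw [← hw]; ring⟩

/-- A proper colon ideal of `J + (a ^ b)` is contained in a proper colon ideal of `J + (a)`. -/
theorem exists_colon_le_of_notMem_sup_span_pow {J : Ideal R} {a : R}
    (ha : ∀ x, a * x ∈ J → x ∈ J) (b : ℕ) :
    ∀ x, x ∉ J ⊔ Ideal.span {a ^ b} → ∃ x', x' ∉ J ⊔ Ideal.span {a} ∧
      ∀ r, r * x ∈ J ⊔ Ideal.span {a ^ b} → r * x' ∈ J ⊔ Ideal.span {a} := by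
  induction b with
  | zero => intro x hx; simp at hx
  | succ b ih =>
    intro x hx
    by_cases h1 : x ∈ J ⊔ Ideal.span {a}
    · obtain ⟨j, hj, z, rfl⟩ := mem_sup_span_singleton_iff.mp h1
      have hz : z ∉ J ⊔ Ideal.span {a ^ b} := by
        intro hz
        obtain ⟨j', hj', w, rfl⟩ := mem_sup_span_singleton_iff.mp hz
        exact hx (mem_sup_span_singleton_iff.mpr
          ⟨j + a * j', J.add_mem hj (J.mul_mem_left _ hj'), w, by ring⟩)
      obtain ⟨x', hx', H⟩ := ih z hz
      refine ⟨x', hx', fun r hr => H r ?_⟩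
      obtain ⟨j', hj', w, hw⟩ := mem_sup_span_singleton_iff.mp hr
      refine mem_sup_span_singleton_iff.mpr ⟨r * z - a ^ b * w, ha _ ?_, w, by ring⟩
      have : a * (r * z - a ^ b * w) = j' - r * j := by linear_combination -hw
      rw [this]
      exact J.sub_mem hj' (J.mul_mem_left _ hj)
    · refine ⟨x, h1, fun r hr => (sup_le_sup_left ?_ J) hr⟩
      rw [Ideal.span_singleton_le_span_singleton]
      exact dvd_pow_self a (Nat.succ_ne_zero b)

variable {n : ℕ}

/-- Each `F q` is a nonzerodivisor modulo any at most `h` of the other members of `F`. -/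
def RegularModSubsets (h : ℕ) (F : Fin n → R) : Prop :=
  ∀ U : Finset (Fin n), U.card ≤ h → ∀ q ∉ U, ∀ x,
    F q * x ∈ Ideal.span (F '' U) → x ∈ Ideal.span (F '' U)

/-- The ideal generated by the powers `F i ^ b i`, `i ∈ S`. -/
def powersIdeal (F : Fin n → R) (b : Fin n → ℕ) (S : Finset (Fin n)) : Ideal R :=
  Ideal.span ((fun i => F i ^ b i) '' S)

theorem powersIdeal_insert (F : Fin n → R) (b : Fin n → ℕ) (S : Finset (Fin n)) (i : Fin n) :
    powersIdeal F b (insert i S) = powersIdeal F b S ⊔ Ideal.span {F i ^ b i} := by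
  simp only [powersIdeal]
  rw [Finset.coe_insert, Set.image_insert_eq, Ideal.span_insert, sup_comm]

theorem powersIdeal_congr {F : Fin n → R} {b b' : Fin n → ℕ} {S : Finset (Fin n)}
    (hb : ∀ i ∈ S, b i = b' i) : powersIdeal F b S = powersIdeal F b' S := by
  simp only [powersIdeal]
  congr 1
  exact Set.image_congr fun i hi => by rw [hb i hi]

theorem pow_mem_powersIdeal {F : Fin n → R} {b : Fin n → ℕ} {S : Finset (Fin n)} {i : Fin n}
    (hi : i ∈ S) : F i ^ b i ∈ powersIdeal F b S :=
  Ideal.subset_span ⟨i, hi, rfl⟩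

theorem span_image_insert (F : Fin n → R) (U : Finset (Fin n)) (i : Fin n) :
    Ideal.span (F '' ↑(insert i U)) = Ideal.span (F '' U) ⊔ Ideal.span {F i} := by
  rw [Finset.coe_insert, Set.image_insert_eq, Ideal.span_insert, sup_comm]

namespace RegularModSubsets

variable {h : ℕ} {F : Fin n → R} (hF : RegularModSubsets h F)

include hF

/-- Raising one generator at a time to its power works if the others may be either powers or plain
forms: the inductive step needs `F t` regular modulo `(T, U)` and `F q` regular modulo `(T, U ∪
{t})`. -/
theorem mem_mixed_of_mul_mem (b : Fin n → ℕ) (T : Finset (Fin n)) :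
    ∀ U : Finset (Fin n), Disjoint T U → T.card + U.card ≤ h → ∀ q ∉ T, q ∉ U → ∀ x,
      F q * x ∈ powersIdeal F b T ⊔ Ideal.span (F '' U) →
        x ∈ powersIdeal F b T ⊔ Ideal.span (F '' U) := by
  induction T using Finset.induction_on with
  | empty =>
    intro U _ hU q _ hq x hx
    simp only [powersIdeal, Finset.coe_empty, Set.image_empty, Ideal.span_empty, bot_sup_eq]
      at hx ⊢
    exact hF U (by simpa using hU) q hq x hx
  | insert t T ht ih =>
    intro U hTU hcard q hqT hqU
    rw [Finset.card_insert_of_notMem ht] at hcard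
    rw [Finset.disjoint_insert_left] at hTU
    rw [Finset.mem_insert, not_or] at hqT
    have e : powersIdeal F b (insert t T) ⊔ Ideal.span (F '' U) =
        powersIdeal F b T ⊔ Ideal.span (F '' U) ⊔ Ideal.span {F t ^ b t} := by
      rw [powersIdeal_insert, sup_right_comm]
    rw [e]
    apply mem_sup_span_pow_of_mul_mem
    · exact ih U hTU.2 (by omega) t ht hTU.1
    · have := ih (insert t U) (Finset.disjoint_insert_right.mpr ⟨ht, hTU.2⟩)
        (by rw [Finset.card_insert_of_notMem hTU.1]; omega) q hqT.2
        (by rw [Finset.mem_insert, not_or]; exact ⟨hqT.1, hqU⟩)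
      rw [span_image_insert, ← sup_assoc] at this
      exact this

theorem mem_powersIdeal_of_mul_mem (b : Fin n → ℕ) {S : Finset (Fin n)} (hS : S.card ≤ h)
    {q : Fin n} (hq : q ∉ S) {x : R} (hx : F q * x ∈ powersIdeal F b S) :
    x ∈ powersIdeal F b S := by
  have := hF.mem_mixed_of_mul_mem b S ∅ (by simp) (by simpa using hS) q hq (by simp) x
  simpa using this (by simpa using hx)

theorem mem_powersIdeal_of_pow_mul_mem (b : Fin n → ℕ) {S : Finset (Fin n)} (hS : S.card ≤ h)
    {q : Fin n} (hq : q ∉ S) (c : ℕ) {x : R} (hx : F q ^ c * x ∈ powersIdeal F b S) :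
    x ∈ powersIdeal F b S := by
  induction c with
  | zero => simpa using hx
  | succ c ih =>
    refine ih (hF.mem_powersIdeal_of_mul_mem b hS hq ?_)
    rwa [← mul_assoc, ← pow_succ']

/-- Divide out one form at a time: a form outside `S` is a nonzerodivisor, and a form in `S` lowers
its own exponent. The set `V` records the forms already divided out. -/
theorem mem_powersIdeal_sub_of_prod_mul_mem (b c : Fin n → ℕ) {S : Finset (Fin n)}
    (hS : S.card ≤ h) (hc : ∀ i ∈ S, c i ≤ b i) (V : Finset (Fin n)) : ∀ {x : R},
      (∏ i ∈ V, F i ^ c i) * x ∈ powersIdeal F b S →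
        x ∈ powersIdeal F (fun i => if i ∈ V then b i - c i else b i) S := by
  induction V using Finset.induction_on with
  | empty => intro x hx; simpa using hx
  | insert q V hq ih =>
    intro x hx
    rw [Finset.prod_insert hq, mul_comm (F q ^ c q), mul_assoc] at hx
    have h1 := ih hx
    by_cases hqS : q ∈ S
    · obtain ⟨T, hqT, rfl⟩ : ∃ T, q ∉ T ∧ insert q T = S :=
        ⟨S.erase q, Finset.notMem_erase q S, Finset.insert_erase hqS⟩
      rw [powersIdeal_insert, if_neg hq] at h1
      rw [powersIdeal_insert, if_pos (Finset.mem_insert_self q V)]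
      obtain ⟨j, hj, y, hy⟩ := mem_sup_span_singleton_iff.mp h1
      have hT : T.card ≤ h := (Finset.card_le_card (Finset.subset_insert q T)).trans hS
      have hcq := hc q hqS
      have h2 : x - y * F q ^ (b q - c q) ∈
          powersIdeal F (fun i => if i ∈ V then b i - c i else b i) T := by
        refine hF.mem_powersIdeal_of_pow_mul_mem _ hT hqT (c q) ?_
        have : F q ^ c q * (x - y * F q ^ (b q - c q)) = j := by
          have e : F q ^ b q = F q ^ c q * F q ^ (b q - c q) := by
            rw [← pow_add, Nat.add_sub_cancel' hcq]
          rw [e] at hy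
          linear_combination -hy
        rwa [this]
      refine mem_sup_span_singleton_iff.mpr ⟨x - y * F q ^ (b q - c q), ?_, y, by ring⟩
      rw [powersIdeal_congr (b' := fun i => if i ∈ V then b i - c i else b i)]
      · exact h2
      · intro i hi
        have : i ≠ q := fun h => hqT (h ▸ hi)
        simp [this]
    · rw [powersIdeal_congr (b' := fun i => if i ∈ V then b i - c i else b i)]
      · exact hF.mem_powersIdeal_of_pow_mul_mem _ hS hqS (c q) h1
      · intro i hi
        have : i ≠ q := fun h => hqS (h ▸ hi)
        simp [this]

theorem mem_powersIdeal_sub_of_monomial_mul_mem {b c : Fin n → ℕ} {S : Finset (Fin n)}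
    (hS : S.card ≤ h) (hc : ∀ i ∈ S, c i ≤ b i) {x : R}
    (hx : (∏ i, F i ^ c i) * x ∈ powersIdeal F b S) :
    x ∈ powersIdeal F (fun i => b i - c i) S := by
  simpa using hF.mem_powersIdeal_sub_of_prod_mul_mem b c hS hc Finset.univ hx

theorem exists_colon_mixed_le (b : Fin n → ℕ) (T : Finset (Fin n)) :
    ∀ U : Finset (Fin n), Disjoint T U → T.card + U.card ≤ h → ∀ x,
      x ∉ powersIdeal F b T ⊔ Ideal.span (F '' U) →
        ∃ x', x' ∉ Ideal.span (F '' ↑(T ∪ U)) ∧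
          ∀ r, r * x ∈ powersIdeal F b T ⊔ Ideal.span (F '' U) →
            r * x' ∈ Ideal.span (F '' ↑(T ∪ U)) := by
  induction T using Finset.induction_on with
  | empty =>
    intro U _ _ x hx
    simp only [powersIdeal, Finset.coe_empty, Set.image_empty, Ideal.span_empty, bot_sup_eq,
      Finset.empty_union] at hx ⊢
    exact ⟨x, hx, fun r hr => hr⟩
  | insert t T ht ih =>
    intro U hTU hcard x hx
    rw [Finset.card_insert_of_notMem ht] at hcard
    rw [Finset.disjoint_insert_left] at hTU
    have e : powersIdeal F b (insert t T) ⊔ Ideal.span (F '' U) =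
        powersIdeal F b T ⊔ Ideal.span (F '' U) ⊔ Ideal.span {F t ^ b t} := by
      rw [powersIdeal_insert, sup_right_comm]
    rw [e] at hx ⊢
    obtain ⟨x₁, hx₁, H₁⟩ := exists_colon_le_of_notMem_sup_span_pow
      (hF.mem_mixed_of_mul_mem b T U hTU.2 (by omega) t ht hTU.1) (b t) x hx
    simp only [sup_assoc (powersIdeal F b T) _ (Ideal.span {F t}), ← span_image_insert] at hx₁ H₁
    obtain ⟨x₂, hx₂, H₂⟩ := ih (insert t U) (Finset.disjoint_insert_right.mpr ⟨ht, hTU.2⟩)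
      (by rw [Finset.card_insert_of_notMem hTU.1]; omega) x₁ hx₁
    rw [Finset.insert_union, ← Finset.union_insert]
    exact ⟨x₂, hx₂, fun r hr => H₂ r (H₁ r hr)⟩

/-- A proper colon ideal of `(F i ^ b i, i ∈ S)` is contained in one of `(F i, i ∈ S)`. -/
theorem exists_colon_powersIdeal_le (b : Fin n → ℕ) {S : Finset (Fin n)} (hS : S.card ≤ h)
    {x : R} (hx : x ∉ powersIdeal F b S) :
    ∃ x', x' ∉ Ideal.span (F '' S) ∧
      ∀ r, r * x ∈ powersIdeal F b S → r * x' ∈ Ideal.span (F '' S) := by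
  have := hF.exists_colon_mixed_le b S ∅ (by simp) (by simpa using hS) x (by simpa using hx)
  simpa using this

/-- If the monomial ideals `(y i ^ b j i, i ∈ S j)`, `j ∈ E`, taken in decreasing order of `j`,
admit a shelling with corners `c j`, then the intersection of the ideals `(F i ^ b j i, i ∈ S j)`
is generated by monomials in `F`. -/
theorem mem_span_monomials_of_shelling {ι : Type*} [LinearOrder ι] (E : Finset ι)
    (S : ι → Finset (Fin n)) (b c : ι → Fin n → ℕ) (hS : ∀ j ∈ E, (S j).card ≤ h)
    (hcb : ∀ j ∈ E, ∀ i ∈ S j, c j i < b j i)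
    (hc : ∀ j ∈ E, ∀ j' ∈ E, j < j' → ∃ i ∈ S j', b j' i ≤ c j i)
    (hmin : ∀ j ∈ E, ∀ a : Fin n → ℕ, (∀ i ∈ S j, a i < b j i) →
      (∀ j' ∈ E, j < j' → ∃ i ∈ S j', b j' i ≤ a i) → c j ≤ a)
    {f : R} (hf : ∀ j ∈ E, f ∈ powersIdeal F (b j) (S j)) :
    f ∈ Ideal.span {x | ∃ a : Fin n → ℕ, (∀ j ∈ E, ∃ i ∈ S j, b j i ≤ a i) ∧
      x = ∏ i, F i ^ a i} := by
  -- The smallest index is added last, so the components enter in decreasing order.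
  induction E using Finset.induction_on_min with
  | empty =>
    have : (1 : R) ∈ {x : R | ∃ a : Fin n → ℕ,
        (∀ j ∈ (∅ : Finset ι), ∃ i ∈ S j, b j i ≤ a i) ∧ x = ∏ i, F i ^ a i} :=
      ⟨0, by simp, by simp⟩
    rw [Ideal.eq_top_of_isUnit_mem _ (Ideal.subset_span this) isUnit_one]
    trivial
  | insert j E hjE ih =>
    have hmem : ∀ x, x ∈ insert j E ↔ x = j ∨ x ∈ E := fun x => Finset.mem_insert
    have hjm : j ∈ insert j E := Finset.mem_insert_self j E
    have hins : ∀ x ∈ E, x ∈ insert j E := fun x => Finset.mem_insert_of_mem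
    generalize insert j E = E' at *
    have hlt : ∀ j₁ ∈ E, ∀ j' ∈ E', j₁ < j' → j' ∈ E := by
      intro j₁ hj₁ j' hj' hlt
      rcases (hmem _).mp hj' with rfl | h'
      · exact absurd hlt (not_lt.mpr (hjE _ hj₁).le)
      · exact h'
    have ih' := ih (fun j hj => hS j (hins _ hj))
      (fun j hj => hcb j (hins _ hj))
      (fun j hj j' hj' => hc j (hins _ hj) j' (hins _ hj'))
      (fun j₁ hj₁ a ha ha' => hmin j₁ (hins _ hj₁) a ha
        fun j' hj' hlt' => ha' j' (hlt j₁ hj₁ j' hj' hlt') hlt')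
      (fun j hj => hf j (hins _ hj))
    set K := Ideal.span {x | ∃ a : Fin n → ℕ, (∀ j ∈ E', ∃ i ∈ S j, b j i ≤ a i) ∧
      x = ∏ i, F i ^ a i} with hK
    have hKP : K ≤ powersIdeal F (b j) (S j) := by
      rw [hK, Ideal.span_le]
      rintro _ ⟨a, ha, rfl⟩
      obtain ⟨i, hi, hia⟩ := ha j hjm
      exact Ideal.mem_of_dvd _ ((pow_dvd_pow _ hia).trans
        (Finset.dvd_prod_of_mem (fun i => F i ^ a i) (Finset.mem_univ i)))
        (pow_mem_powersIdeal hi)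
    -- A monomial generator for `E` either lies in the new component too, hence in `K`, or is
    -- divisible by the corner monomial by `hmin`.
    have hle : f ∈ K ⊔ Ideal.span {∏ i, F i ^ c j i} := by
      revert ih'
      suffices h' : Ideal.span {x | ∃ a : Fin n → ℕ, (∀ j ∈ E, ∃ i ∈ S j, b j i ≤ a i) ∧
          x = ∏ i, F i ^ a i} ≤ K ⊔ Ideal.span {∏ i, F i ^ c j i} from fun hx => h' hx
      rw [Ideal.span_le]
      rintro _ ⟨a, ha, rfl⟩
      by_cases haj : ∃ i ∈ S j, b j i ≤ a i
      · refine Ideal.mem_sup_left (Ideal.subset_span ⟨a, fun j' hj' => ?_, rfl⟩)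
        rcases (hmem _).mp hj' with h' | h'
        · rw [h']; exact haj
        · exact ha j' h'
      · push Not at haj
        refine Ideal.mem_sup_right (Ideal.mem_span_singleton.mpr ?_)
        have := hmin j hjm a haj fun j' hj' hlt' => by
          rcases (hmem _).mp hj' with h' | h'
          · exact absurd (h' ▸ hlt') (lt_irrefl _)
          · exact ha j' h'
        exact Finset.prod_dvd_prod_of_dvd _ _ fun i _ => pow_dvd_pow _ (this i)
    obtain ⟨g, hg, x, hgx⟩ := mem_sup_span_singleton_iff.mp hle
    have hx : (∏ i, F i ^ c j i) * x ∈ powersIdeal F (b j) (S j) := by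
      have : (∏ i, F i ^ c j i) * x = f - g := by rw [← hgx]; ring
      rw [this]
      exact Ideal.sub_mem _ (hf j hjm) (hKP hg)
    have hx' := hF.mem_powersIdeal_sub_of_monomial_mul_mem (hS j hjm)
      (fun i hi => (hcb j hjm i hi).le) hx
    rw [← hgx]
    refine Ideal.add_mem _ hg ?_
    rw [mul_comm]
    -- Multiplying the corner by a generator of the colon raises one entry `i` to `b j i`. This
    -- enters component `j`, and `hc` keeps the monomial in the others.
    have : powersIdeal F (fun i => b j i - c j i) (S j) * Ideal.span {∏ i, F i ^ c j i} ≤ K := by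
      rw [powersIdeal, Ideal.span_mul_span', Ideal.span_le]
      rintro _ ⟨_, ⟨i, hi, rfl⟩, _, rfl, rfl⟩
      refine Ideal.subset_span ⟨fun l => if l = i then b j i else c j l, ?_, ?_⟩
      · intro j' hj'
        rcases (hmem _).mp hj' with rfl | h'
        · exact ⟨i, hi, by simp⟩
        · obtain ⟨l, hl, hlc⟩ := hc j hjm j' hj' (hjE j' h')
          refine ⟨l, hl, hlc.trans ?_⟩
          dsimp only
          split_ifs with hli
          · rw [hli]; exact (hcb j hjm i hi).le
          · exact le_rfl
      · have hlt' := hcb j hjm i hi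
        rw [← Finset.mul_prod_erase _ _ (Finset.mem_univ i),
          ← Finset.mul_prod_erase _ (fun l => F l ^ (if l = i then b j i else c j l))
            (Finset.mem_univ i)]
        simp only [if_true]
        rw [← mul_assoc, ← pow_add, Nat.sub_add_cancel hlt'.le]
        congr 1
        exact Finset.prod_congr rfl fun l hl => by rw [if_neg (Finset.ne_of_mem_erase hl)]
    exact this (Ideal.mul_mem_mul hx' (Ideal.mem_span_singleton_self _))

end RegularModSubsets

end RegularPowers

/-! ### Lexicographic shelling of the exponent vectors. -/

section Facets

variable {n : ℕ}

/-- The indices at which the entries of `e` are less than `s`. -/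
def smallIndices (s : ℕ) (e : Fin n → ℕ) : Finset (Fin n) :=
  Finset.univ.filter fun i => e i < s

@[simp] theorem mem_smallIndices {s : ℕ} {e : Fin n → ℕ} {i : Fin n} :
    i ∈ smallIndices s e ↔ e i < s := by
  simp [smallIndices]

/-- Exponent vectors (with `s` in the role of infinity) of the irreducible components
`(y i ^ (e i + 1) : e i < s)` of the intersection of the ideals `(y i, i ∈ S) ^ s`, `|S| = h`. -/
structure IsStarFacet (h s : ℕ) (e : Fin n → ℕ) : Prop where
  le : ∀ i, e i ≤ s
  card : (smallIndices s e).card = h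
  sum : ∑ i ∈ smallIndices s e, e i + 1 = s

/-- The least exponent vector below the facet `e` which is below no lexicographically greater
facet. -/
def shellingCorner (s : ℕ) (e : Fin n → ℕ) (i : Fin n) : ℕ :=
  if ∃ l < i, e l < s then
    if e i < s then e i else (smallIndices s e).sup fun l => if l < i then e l + 1 else e l
  else 0

theorem shellingCorner_le {s : ℕ} {e : Fin n → ℕ} {i : Fin n} (hi : e i < s) :
    shellingCorner s e i ≤ e i := by
  unfold shellingCorner
  split_ifs <;> simp

theorem Finset.sum_le_sum_of_card_eq {α β : Type*} {A : Finset α} {B : Finset β}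
    (hAB : A.card = B.card) {f : α → ℕ} {g : β → ℕ} (hfg : ∀ a ∈ A, ∀ b ∈ B, f a ≤ g b) :
    ∑ a ∈ A, f a ≤ ∑ b ∈ B, g b := by
  calc ∑ a ∈ A, f a ≤ A.card • A.sup f := Finset.sum_le_card_nsmul _ _ _ fun a ha =>
        Finset.le_sup (f := f) ha
    _ = B.card • A.sup f := by rw [hAB]
    _ ≤ ∑ b ∈ B, g b := Finset.card_nsmul_le_sum _ _ _ fun b hb =>
        Finset.sup_le fun a ha => hfg a ha b hb

namespace IsStarFacet

variable {h s : ℕ} {e : Fin n → ℕ}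

/-- Otherwise the corner of `e` is below `e'`. Let `p` be the first difference. Comparing entries on
the common small indices, and every entry of `A \ B` with every entry of `B \ A`, gives `∑ e + 1 ≤ ∑
e'`, the extra unit coming from `p`; but both sums are `s - 1`. -/
theorem shellingCorner_not_below (he : IsStarFacet h s e) {e' : Fin n → ℕ}
    (he' : IsStarFacet h s e') (hlt : toLex e < toLex e') :
    ∃ i ∈ smallIndices s e', e' i + 1 ≤ shellingCorner s e i := by
  by_contra! hcon
  obtain ⟨p, hp, hpe⟩ := hlt
  simp only [Pi.toLex_apply] at hp hpe
  have hps : e p < s := hpe.trans_le (he'.le p)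
  set A := smallIndices s e with hA
  set B := smallIndices s e' with hB
  have hBA : ∀ q ∈ B, q ∉ A → p < q := by
    intro q hq hqA
    simp only [hA, hB, mem_smallIndices] at hq hqA
    rcases lt_trichotomy q p with h1 | rfl | h1
    · have := hp q h1
      omega
    · exact absurd hps hqA
    · exact h1
  have hcorner : ∀ q ∈ B, p < q → ∀ i ∈ A, (i = q ∨ q ∉ A) →
      e i + (if i = p then 1 else 0) ≤ e' q := by
    intro q hq hpq i hi hiq
    have h1 := hcon q hq
    have hex : ∃ l < q, e l < s := ⟨p, hpq, hps⟩
    rw [shellingCorner, if_pos hex] at h1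
    rcases hiq with rfl | hqA
    · rw [if_pos (mem_smallIndices.mp hi)] at h1
      rw [if_neg hpq.ne']
      omega
    · rw [if_neg (fun h => hqA (mem_smallIndices.mpr h))] at h1
      have h2 : (if i < q then e i + 1 else e i) ≤ _ :=
        Finset.le_sup (f := fun l => if l < q then e l + 1 else e l) hi
      have h3 : e i + (if i = p then 1 else 0) ≤ if i < q then e i + 1 else e i := by
        by_cases hip : i = p
        · subst hip; simp [hpq]
        · rw [if_neg hip]; split_ifs <;> omega
      exact h3.trans (h2.trans (Nat.lt_succ_iff.mp h1))
  have hAsum : ∑ i ∈ A, (e i + if i = p then 1 else 0) = s := by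
    rw [Finset.sum_add_distrib, Finset.sum_ite_eq' A p, if_pos (by simpa [hA] using hps)]
    exact he.sum
  have hcard : (A \ B).card = (B \ A).card := by
    have h1 := Finset.card_sdiff_add_card_inter A B
    have h2 := Finset.card_sdiff_add_card_inter B A
    rw [Finset.inter_comm B A] at h2
    have h3 : A.card = h := he.card
    have h4 : B.card = h := he'.card
    omega
  have hle : ∑ i ∈ A, (e i + if i = p then 1 else 0) ≤ ∑ i ∈ B, e' i := by
    rw [← Finset.sum_inter_add_sum_sdiff A B, ← Finset.sum_inter_add_sum_sdiff B A,
      Finset.inter_comm B A]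
    refine add_le_add (Finset.sum_le_sum fun i hi => ?_)
      (Finset.sum_le_sum_of_card_eq hcard fun i hi q hq => ?_)
    · rw [Finset.mem_inter] at hi
      rcases lt_trichotomy i p with h1 | rfl | h1
      · rw [if_neg h1.ne, hp i h1]; omega
      · rw [if_pos rfl]; exact hpe
      · exact hcorner i hi.2 h1 i hi.1 (Or.inl rfl)
    · rw [Finset.mem_sdiff] at hi hq
      exact hcorner q hq.1 (hBA q hq.1 hq.2) i hi.1 (Or.inr hq.2)
  have : ∑ i ∈ B, e' i + 1 = s := he'.sum
  rw [hAsum] at hle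
  omega

/-- If `a` is smaller than the corner at some `q`, a local move on `e` gives a lexicographically
greater facet that is still above `a`. -/
theorem shellingCorner_le_of_not_below (he : IsStarFacet h s e) {a : Fin n → ℕ}
    (ha : ∀ i ∈ smallIndices s e, a i < e i + 1)
    (hnew : ∀ e', IsStarFacet h s e' → toLex e < toLex e' →
      ∃ i ∈ smallIndices s e', e' i + 1 ≤ a i) :
    shellingCorner s e ≤ a := by
  have hlex : ∀ (e' : Fin n → ℕ) (p : Fin n), (∀ j < p, e j = e' j) → e p < e' p →
      toLex e < toLex e' := fun e' p h1 h2 => ⟨p, h1, h2⟩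
  have key : ∀ e', IsStarFacet h s e' → (∃ p : Fin n, (∀ j < p, e j = e' j) ∧ e p < e' p) →
      (∀ i, e' i < s → a i ≤ e' i) → False := by
    rintro e' he' ⟨p, hp, hpe⟩ hae
    obtain ⟨i, hi, hia⟩ := hnew e' he' (hlex e' p hp hpe)
    have := hae i (mem_smallIndices.mp hi)
    omega
  have ha' : ∀ i, e i < s → a i ≤ e i := fun i hi =>
    Nat.lt_succ_iff.mp (ha i (mem_smallIndices.mpr hi))
  -- Two small entries sum to at most `s - 1`, so a unit added to one of them keeps it below `s`
  -- when the other is positive.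
  have hpair : ∀ i q : Fin n, i ≠ q → e i < s → e q < s → e i + e q + 1 ≤ s := by
    intro i q hiq hi hq
    have h1 := he.sum
    have h2 : ∑ l ∈ {i, q}, e l ≤ ∑ l ∈ smallIndices s e, e l :=
      Finset.sum_le_sum_of_subset (by
        intro l hl
        rcases Finset.mem_insert.mp hl with rfl | hl
        · simpa using hi
        · rw [Finset.mem_singleton.mp hl]; simpa using hq)
    rw [Finset.sum_pair hiq] at h2
    omega
  intro q
  change shellingCorner s e q ≤ a q
  unfold shellingCorner
  split_ifs with hex hq
  · obtain ⟨i, hiq, hi⟩ := hex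
    by_contra! hlt
    have hpq := hpair i q hiq.ne hi hq
    -- Move one unit from `q` to the earlier small index `i`.
    have hS : smallIndices s (Function.update (Function.update e i (e i + 1)) q (e q - 1)) =
        smallIndices s e := by
      ext l
      simp only [mem_smallIndices, Function.update_apply]
      split_ifs with h1 h2
      · subst h1; omega
      · subst h2; omega
      · rfl
    refine key (Function.update (Function.update e i (e i + 1)) q (e q - 1)) ⟨?_, ?_, ?_⟩
      ⟨i, ?_, ?_⟩ ?_
    · intro l
      have := he.le l
      simp only [Function.update_apply]
      split_ifs <;> omega
    · rw [hS]; exact he.card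
    · rw [hS]
      have hq' : q ∈ smallIndices s e := mem_smallIndices.mpr hq
      have hi' : i ∈ (smallIndices s e).erase q :=
        Finset.mem_erase.mpr ⟨hiq.ne, mem_smallIndices.mpr hi⟩
      have h0 := he.sum
      rw [← Finset.add_sum_erase _ _ hq', ← Finset.add_sum_erase _ _ hi'] at h0 ⊢
      have : ∑ x ∈ ((smallIndices s e).erase q).erase i,
          Function.update (Function.update e i (e i + 1)) q (e q - 1) x =
          ∑ x ∈ ((smallIndices s e).erase q).erase i, e x := by
        refine Finset.sum_congr rfl fun l hl => ?_
        have h1 := Finset.ne_of_mem_erase hl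
        have h2 := Finset.ne_of_mem_erase (Finset.mem_of_mem_erase hl)
        simp [h1, h2]
      rw [this]
      simp only [Function.update_apply, if_neg hiq.ne, if_true]
      omega
    · intro l hl
      simp [hl.ne, (hl.trans hiq).ne]
    · simp [hiq.ne]
    · intro l hl
      simp only [Function.update_apply] at hl ⊢
      split_ifs at hl ⊢ with h1 h2
      · subst h1; omega
      · subst h2; have := ha' _ hi; omega
      · exact ha' l hl
  · obtain ⟨i₀, hi₀q, hi₀⟩ := hex
    refine Finset.sup_le fun i hi => ?_
    rw [mem_smallIndices] at hi
    have hqs : e q = s := le_antisymm (he.le q) (not_lt.mp hq)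
    have hiq : i ≠ q := fun h => hq (h ▸ hi)
    have hi' : i ∈ smallIndices s e := mem_smallIndices.mpr hi
    have hq' : q ∉ smallIndices s e := fun h => hq (mem_smallIndices.mp h)
    by_contra! hlt
    by_cases hiq' : i < q
    · rw [if_pos hiq'] at hlt
      -- Exchange `i` for `q`, carrying the entry along; raising the earlier entry `i` to `s` makes
      -- the vector greater.
      have hS : smallIndices s (Function.update (Function.update e i s) q (e i)) =
          insert q ((smallIndices s e).erase i) := by
        ext l
        simp only [mem_smallIndices, Function.update_apply, Finset.mem_insert, Finset.mem_erase]
        split_ifs with h1 h2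
        · subst h1; simp [hi]
        · subst h2; simp [h1]
        · simp [h1, h2]
      refine key (Function.update (Function.update e i s) q (e i)) ⟨?_, ?_, ?_⟩ ⟨i, ?_, ?_⟩ ?_
      · intro l
        have := he.le l
        simp only [Function.update_apply]
        split_ifs <;> omega
      · rw [hS, Finset.card_insert_of_notMem (fun h => hq' (Finset.mem_of_mem_erase h)),
          Finset.card_erase_add_one hi']
        exact he.card
      · rw [hS, Finset.sum_insert (fun h => hq' (Finset.mem_of_mem_erase h))]
        have h0 := he.sum
        rw [← Finset.add_sum_erase _ _ hi'] at h0
        have : ∑ x ∈ (smallIndices s e).erase i,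
            Function.update (Function.update e i s) q (e i) x =
            ∑ x ∈ (smallIndices s e).erase i, e x := by
          refine Finset.sum_congr rfl fun l hl => ?_
          have h1 := Finset.ne_of_mem_erase hl
          have h2 : l ≠ q := fun h => hq' (h ▸ Finset.mem_of_mem_erase hl)
          simp [h1, h2]
        rw [this]
        simpa using h0
      · intro l hl
        simp [hl.ne, (hl.trans hiq').ne]
      · simp [hiq, hi]
      · intro l hl
        simp only [Function.update_apply] at hl ⊢
        split_ifs at hl ⊢ with h1 h2
        · subst h1; omega
        · omega
        · exact ha' l hl
    · rw [if_neg hiq'] at hlt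
      have hne : i₀ ≠ i := fun h => hiq' (h ▸ hi₀q)
      have hpq := hpair i₀ i hne hi₀ hi
      -- Here `q < i`, so the exchange alone would lower the vector. One unit of `e i` goes to `i₀ <
      -- q`, which accounts for the bound `e i` in place of `e i + 1`.
      have hS : smallIndices s (Function.update (Function.update (Function.update e i s) q
          (e i - 1)) i₀ (e i₀ + 1)) = insert q ((smallIndices s e).erase i) := by
        ext l
        simp only [mem_smallIndices, Function.update_apply, Finset.mem_insert, Finset.mem_erase]
        split_ifs with h1 h2 h3
        · subst h1; simp [hi₀, hne]; omega
        · subst h2; simp; omega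
        · subst h3; simp [h2]
        · simp [h2, h3]
      have hi₀' : i₀ ∈ (smallIndices s e).erase i :=
        Finset.mem_erase.mpr ⟨hne, mem_smallIndices.mpr hi₀⟩
      refine key (Function.update (Function.update (Function.update e i s) q
          (e i - 1)) i₀ (e i₀ + 1)) ⟨?_, ?_, ?_⟩ ⟨i₀, ?_, ?_⟩ ?_
      · intro l
        have := he.le l
        simp only [Function.update_apply]
        split_ifs <;> omega
      · rw [hS, Finset.card_insert_of_notMem (fun h => hq' (Finset.mem_of_mem_erase h)),
          Finset.card_erase_add_one hi']
        exact he.card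
      · rw [hS, Finset.sum_insert (fun h => hq' (Finset.mem_of_mem_erase h))]
        have h0 := he.sum
        rw [← Finset.add_sum_erase _ _ hi', ← Finset.add_sum_erase _ _ hi₀'] at h0
        rw [← Finset.add_sum_erase _ _ hi₀']
        have : ∑ x ∈ ((smallIndices s e).erase i).erase i₀,
            Function.update (Function.update (Function.update e i s) q
              (e i - 1)) i₀ (e i₀ + 1) x =
            ∑ x ∈ ((smallIndices s e).erase i).erase i₀, e x := by
          refine Finset.sum_congr rfl fun l hl => ?_
          have h1 := Finset.ne_of_mem_erase hl
          have h3 := Finset.mem_of_mem_erase hl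
          have h4 := Finset.ne_of_mem_erase h3
          have h2 : l ≠ q := fun h => hq' (h ▸ Finset.mem_of_mem_erase h3)
          simp [h1, h2, h4]
        rw [this]
        simp only [Function.update_apply, if_neg hi₀q.ne', if_true]
        omega
      · intro l hl
        have : l ≠ i := fun h => hiq' (h ▸ hl.trans hi₀q)
        simp [hl.ne, (hl.trans hi₀q).ne, this]
      · simp
      · intro l hl
        simp only [Function.update_apply] at hl ⊢
        split_ifs at hl ⊢ with h1 h2 h3
        · subst h1; have := ha' _ hi₀; omega
        · subst h2; omega
        · omega
        · exact ha' l hl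
  · exact Nat.zero_le _

end IsStarFacet

/-- An exponent vector below no facet has all its `h`-fold sums at least `s`. -/
theorem le_sum_of_forall_isStarFacet {h s : ℕ} (hh : 1 ≤ h) {a : Fin n → ℕ}
    (ha : ∀ e, IsStarFacet h s e → ∃ i ∈ smallIndices s e, e i + 1 ≤ a i)
    {S : Finset (Fin n)} (hS : S.card = h) : s ≤ ∑ i ∈ S, a i := by
  by_contra! hlt
  obtain ⟨i₀, hi₀⟩ : S.Nonempty := by rw [← Finset.card_pos]; omega
  have hsum := Finset.add_sum_erase S a hi₀
  have hle : ∀ l ∈ S, a l ≤ ∑ i ∈ S, a i := fun l hl =>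
    Finset.single_le_sum (f := a) (fun _ _ => Nat.zero_le _) hl
  -- Put all the slack on `i₀` to bring the sum over `S` up to exactly `s - 1`.
  set e : Fin n → ℕ := fun l =>
    if l ∈ S then (if l = i₀ then a l + (s - 1 - ∑ i ∈ S, a i) else a l) else s with he
  have hsmall : smallIndices s e = S := by
    ext l
    rw [mem_smallIndices]
    by_cases hl : l ∈ S
    · have h2 := hle l hl
      simp only [he, hl, if_true, iff_true]
      split_ifs <;> omega
    · simp [he, hl]
  have hfacet : IsStarFacet h s e := by
    refine ⟨fun l => ?_, ?_, ?_⟩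
    · by_cases hl : l ∈ S
      · exact (mem_smallIndices.mp (hsmall ▸ hl)).le
      · simp [he, hl]
    · rw [hsmall, hS]
    · rw [hsmall, ← Finset.add_sum_erase S e hi₀]
      have : ∑ x ∈ S.erase i₀, e x = ∑ x ∈ S.erase i₀, a x := by
        refine Finset.sum_congr rfl fun l hl => ?_
        simp [he, Finset.mem_of_mem_erase hl, Finset.ne_of_mem_erase hl]
      rw [this]
      simp only [he, hi₀, if_true]
      omega
  obtain ⟨i, hi, hia⟩ := ha e hfacet
  rw [hsmall] at hi
  simp only [he, hi, if_true] at hia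
  split_ifs at hia <;> omega

end Facets

/-! ### Symbolic powers as monomial ideals. -/

section StarIdeals

variable {R : Type*} [CommRing R]

theorem mem_symbolicPower_iff {I : Ideal R} {s : ℕ} {x : R} :
    x ∈ symbolicPower I s ↔ ∀ p ∈ associatedPrimes R (R ⧸ I), ∃ v ∉ p, v * x ∈ I ^ s := by
  simp only [symbolicPower, Submodule.mem_iInf, Subtype.forall]
  refine forall₂_congr fun p hp => ?_
  have : p.IsPrime := hp.isPrime
  rw [Ideal.mem_comap, IsLocalization.algebraMap_mem_map_algebraMap_iff p.primeCompl]
  rfl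

theorem pow_mem_symbolicPower {I : Ideal R} {s : ℕ} {x : R} (hx : x ∈ symbolicPower I s) (q : ℕ) :
    x ^ q ∈ symbolicPower I (s * q) := by
  rw [mem_symbolicPower_iff] at hx ⊢
  intro p hp
  obtain ⟨v, hv, hvx⟩ := hx p hp
  refine ⟨v ^ q, fun h => hv (hp.isPrime.mem_of_pow_mem q h), ?_⟩
  rw [← mul_pow, pow_mul]
  exact Ideal.pow_mem_pow hvx q

variable {n : ℕ}

/-- The intersection of the ideals generated by `h` of the elements `F i`. -/
def subsetsIdeal (h : ℕ) (F : Fin n → R) : Ideal R :=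
  ⨅ S ∈ {S : Finset (Fin n) | S.card = h}, Ideal.span (F '' (S : Set (Fin n)))

/-- The ideal generated by the monomials in `F` all of whose `h`-fold exponent sums are at
least `s`. -/
def monomialSymbolicPower (h : ℕ) (F : Fin n → R) (s : ℕ) : Ideal R :=
  Ideal.span {x | ∃ a : Fin n → ℕ, (∀ S : Finset (Fin n), S.card = h → s ≤ ∑ i ∈ S, a i) ∧
    x = ∏ i, F i ^ a i}

theorem mem_subsetsIdeal {h : ℕ} {F : Fin n → R} {x : R} :
    x ∈ subsetsIdeal h F ↔ ∀ S : Finset (Fin n), S.card = h → x ∈ Ideal.span (F '' S) := by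
  simp [subsetsIdeal, Submodule.mem_iInf]

theorem subsetsIdeal_le {h : ℕ} {F : Fin n → R} {S : Finset (Fin n)} (hS : S.card = h) :
    subsetsIdeal h F ≤ Ideal.span (F '' S) :=
  fun _ hx => mem_subsetsIdeal.mp hx S hS

/-- Multiplication by the remaining forms takes `(F i, i ∈ S)` into the star ideal. -/
theorem prod_compl_mul_mem_subsetsIdeal {h : ℕ} {F : Fin n → R} {S : Finset (Fin n)}
    (hS : S.card = h) {x : R} (hx : x ∈ Ideal.span (F '' S)) :
    (∏ j ∈ Sᶜ, F j) * x ∈ subsetsIdeal h F := by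
  rw [mem_subsetsIdeal]
  intro T hT
  by_cases hTS : T ⊆ S
  · rw [Finset.eq_of_subset_of_card_le hTS (by rw [hS, hT])]
    exact Ideal.mul_mem_left _ _ hx
  · obtain ⟨j, hjT, hjS⟩ := Finset.not_subset.mp hTS
    refine Ideal.mul_mem_right _ _ (Ideal.mem_of_dvd _
      (Finset.dvd_prod_of_mem F (Finset.mem_compl.mpr hjS)) (Ideal.subset_span ⟨j, hjT, rfl⟩))

/-- Pigeonhole: a monomial of degree `∑ e i + 1` has some exponent above `e i`. -/
theorem span_image_pow_le_powersIdeal (F : Fin n → R) (e : Fin n → ℕ) (S : Finset (Fin n)) :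
    Ideal.span (F '' S) ^ (∑ i ∈ S, e i + 1) ≤ powersIdeal F (fun i => e i + 1) S := by
  induction S using Finset.induction_on with
  | empty => simp
  | insert i S hi ih =>
    rw [powersIdeal_insert, span_image_insert, Finset.sum_insert hi, ← Ideal.add_eq_sup, add_pow,
      Ideal.sum_eq_sup]
    refine Finset.sup_le fun k _ => Ideal.mul_le_left.trans ?_
    rcases le_or_gt (∑ i ∈ S, e i + 1) k with hk | hk
    · exact Ideal.mul_le_left.trans ((Ideal.pow_le_pow_right hk).trans (ih.trans le_sup_left))
    · refine Ideal.mul_le_right.trans ?_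
      rw [Ideal.span_singleton_pow]
      refine le_trans ?_ le_sup_right
      rw [Ideal.span_singleton_le_span_singleton]
      exact pow_dvd_pow _ (by omega)

theorem prod_pow_mem_span_image_pow {h s : ℕ} (F : Fin n → R) {a : Fin n → ℕ}
    (ha : ∀ S : Finset (Fin n), S.card = h → s ≤ ∑ i ∈ S, a i) {S : Finset (Fin n)}
    (hS : S.card = h) : ∏ i, F i ^ a i ∈ Ideal.span (F '' S) ^ s := by
  refine Ideal.pow_le_pow_right (ha S hS) ?_
  refine Ideal.mem_of_dvd _ (Finset.prod_dvd_prod_of_subset S _ _ (Finset.subset_univ S)) ?_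
  rw [← Finset.prod_pow_eq_pow_sum]
  exact Ideal.prod_mem_prod fun i hi => Ideal.pow_mem_pow (Ideal.subset_span (Set.mem_image_of_mem F hi)) _

namespace RegularModSubsets

variable {h : ℕ} {F : Fin n → R} (hF : RegularModSubsets h F)

include hF

theorem mem_span_of_prod_mul_mem {S T : Finset (Fin n)} (hS : S.card ≤ h)
    (hTS : ∀ j ∈ T, j ∉ S) {x : R} (hx : (∏ j ∈ T, F j) * x ∈ Ideal.span (F '' S)) :
    x ∈ Ideal.span (F '' S) := by
  induction T using Finset.induction_on generalizing x with
  | empty => simpa using hx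
  | insert t T ht ih =>
    rw [Finset.prod_insert ht, mul_assoc] at hx
    exact ih (fun j hj => hTS j (Finset.mem_insert_of_mem hj))
      (hF S hS t (hTS t (Finset.mem_insert_self t T)) _ hx)

theorem mem_monomialSymbolicPower_of_forall_facet (hh : 1 ≤ h) {s : ℕ} {f : R}
    (hf : ∀ e, IsStarFacet h s e → f ∈ powersIdeal F (fun i => e i + 1) (smallIndices s e)) :
    f ∈ monomialSymbolicPower h F s := by
  -- Using `s` rather than infinity as the cap makes the set of facets finite.
  have hfin : {e : Lex (Fin n → ℕ) | IsStarFacet h s (ofLex e)}.Finite :=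
    (Set.finite_Iic (fun _ : Fin n => s)).subset fun e he => he.le
  have hE : ∀ e, e ∈ hfin.toFinset ↔ IsStarFacet h s (ofLex e) := fun e => hfin.mem_toFinset
  have := hF.mem_span_monomials_of_shelling hfin.toFinset
    (fun e => smallIndices s (ofLex e)) (fun e i => ofLex e i + 1)
    (fun e => shellingCorner s (ofLex e))
    (fun e he => ((hE e).mp he).card.le)
    (fun e he i hi => Nat.lt_succ_iff.mpr (shellingCorner_le (mem_smallIndices.mp hi)))
    (fun e he e' he' hlt => ((hE e).mp he).shellingCorner_not_below ((hE e').mp he') hlt)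
    (fun e he a ha hnew => ((hE e).mp he).shellingCorner_le_of_not_below ha
      fun e' he' hlt => hnew (toLex e') ((hE _).mpr he') hlt)
    (fun e he => hf _ ((hE e).mp he))
  refine Ideal.span_mono ?_ this
  rintro _ ⟨a, ha, rfl⟩
  exact ⟨a, fun S hS => le_sum_of_forall_isStarFacet hh
    (fun e he => ha (toLex e) ((hE _).mpr he)) hS, rfl⟩

/-- If `f` misses a component, its colon ideal there lies in a proper colon ideal of `(F i, i ∈ S)`.
Multiplying by the complementary forms makes this an annihilator in `R/I`, contained in an
associated prime `p`. A multiplier `v ∉ p` with `v * f ∈ I ^ s` would then lie in `p`. -/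
theorem symbolicPower_le_monomialSymbolicPower [IsNoetherianRing R] (hh : 1 ≤ h) (s : ℕ) :
    symbolicPower (subsetsIdeal h F) s ≤ monomialSymbolicPower h F s := by
  intro f hf
  rw [mem_symbolicPower_iff] at hf
  refine hF.mem_monomialSymbolicPower_of_forall_facet hh fun e he => ?_
  by_contra hfe
  set S := smallIndices s e
  have hS : S.card = h := he.card
  obtain ⟨x, hx, H⟩ := hF.exists_colon_powersIdeal_le (fun i => e i + 1) hS.le hfe
  have hux : (∏ j ∈ Sᶜ, F j) * x ∉ subsetsIdeal h F := fun hmem =>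
    hx (hF.mem_span_of_prod_mul_mem hS.le (fun j hj => Finset.mem_compl.mp hj)
      (subsetsIdeal_le hS hmem))
  obtain ⟨p, hp, hle⟩ := exists_le_isAssociatedPrime_of_isNoetherianRing R
    (Ideal.Quotient.mk (subsetsIdeal h F) ((∏ j ∈ Sᶜ, F j) * x))
    (fun h0 => hux (Ideal.Quotient.eq_zero_iff_mem.mp h0))
  obtain ⟨v, hv, hvf⟩ := hf p hp
  refine hv (hle ?_)
  have h1 : v * f ∈ powersIdeal F (fun i => e i + 1) S := by
    refine span_image_pow_le_powersIdeal F e S ?_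
    have hsum : ∑ i ∈ S, e i + 1 = s := he.sum
    rw [hsum]
    exact Ideal.pow_right_mono (subsetsIdeal_le hS) s hvf
  have h2 := prod_compl_mul_mem_subsetsIdeal hS (H v h1)
  rw [Submodule.mem_colon_singleton, Submodule.mem_bot, Algebra.smul_def,
    Ideal.Quotient.algebraMap_eq, ← map_mul, Ideal.Quotient.eq_zero_iff_mem]
  rwa [mul_left_comm] at h2

/-- An associated prime annihilates the class of some `x` outside some `(F i, i ∈ S)`. The product
of the complementary forms is regular modulo that ideal, so it avoids the prime; its `s`-th power is
the required multiplier. -/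
theorem monomialSymbolicPower_le_symbolicPower [IsNoetherianRing R] (s : ℕ) :
    monomialSymbolicPower h F s ≤ symbolicPower (subsetsIdeal h F) s := by
  rw [monomialSymbolicPower, Ideal.span_le]
  rintro _ ⟨a, ha, rfl⟩
  rw [SetLike.mem_coe, mem_symbolicPower_iff]
  intro p hp
  obtain ⟨hprime, y, hy⟩ := (isAssociatedPrime_iff).mp hp
  obtain ⟨x, rfl⟩ := Ideal.Quotient.mk_surjective y
  have hmem : ∀ r, r ∈ p ↔ r * x ∈ subsetsIdeal h F := by
    intro r
    rw [hy, Submodule.mem_colon_singleton, Submodule.mem_bot, Algebra.smul_def,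
      Ideal.Quotient.algebraMap_eq, ← map_mul, Ideal.Quotient.eq_zero_iff_mem]
  have hx : x ∉ subsetsIdeal h F := fun hx =>
    hprime.ne_top ((Ideal.eq_top_iff_one p).mpr ((hmem 1).mpr (by rwa [one_mul])))
  rw [mem_subsetsIdeal] at hx
  push Not at hx
  obtain ⟨S, hS, hxS⟩ := hx
  refine ⟨(∏ j ∈ Sᶜ, F j) ^ s, fun hu => ?_, ?_⟩
  · refine hxS (hF.mem_span_of_prod_mul_mem hS.le (fun j hj => Finset.mem_compl.mp hj)
      (subsetsIdeal_le hS ((hmem _).mp (hprime.mem_of_pow_mem s hu))))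
  · have h1 : Ideal.span {∏ j ∈ Sᶜ, F j} * Ideal.span (F '' S) ≤ subsetsIdeal h F := by
      rw [Ideal.span_singleton_mul_le_iff]
      exact fun z hz => prod_compl_mul_mem_subsetsIdeal hS hz
    refine Ideal.pow_right_mono h1 s ?_
    rw [mul_pow]
    exact Ideal.mul_mem_mul (Ideal.pow_mem_pow (Ideal.mem_span_singleton_self _) s)
      (prod_pow_mem_span_image_pow F ha hS)

end RegularModSubsets

/-! ### Splitting exponent vectors. -/

theorem exists_le_sum_add_eq {q : Fin n → ℕ} {d : ℕ} (hd : d ≤ ∑ i, q i) :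
    ∃ b : Fin n → ℕ, b ≤ q ∧ ∑ i, b i + d = ∑ i, q i := by
  induction d with
  | zero => exact ⟨q, le_rfl, rfl⟩
  | succ d ih =>
    obtain ⟨b, hb, hsum⟩ := ih (by omega)
    obtain ⟨i, -, hi⟩ : ∃ i ∈ Finset.univ, b i ≠ 0 :=
      Finset.exists_ne_zero_of_sum_ne_zero (by omega)
    have hle : Function.update b i (b i - 1) ≤ b :=
      update_le_self_iff.mpr (Nat.sub_le _ _)
    refine ⟨_, hle.trans hb, ?_⟩
    rw [Finset.sum_update_of_mem (Finset.mem_univ i)]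
    rw [← Finset.add_sum_erase _ _ (Finset.mem_univ i), Finset.erase_eq] at hsum
    omega

/-- `a` is the sum of `r` copies of a vector with `h`-fold sums at least `m` and of a
nonnegative vector of degree at least `r (h - 1)`. -/
theorem exists_smul_le_of_le_sum {h m r : ℕ} (hh : 1 ≤ h) (hn : h ≤ n) (hr : 1 ≤ r)
    {a : Fin n → ℕ}
    (ha : ∀ S : Finset (Fin n), S.card = h → r * (m + h - 1) ≤ ∑ i ∈ S, a i) :
    ∃ b : Fin n → ℕ, (∀ i, r * b i ≤ a i) ∧
      (∀ S : Finset (Fin n), S.card = h → m ≤ ∑ i ∈ S, b i) ∧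
      r * (h - 1) ≤ ∑ i, (a i - r * b i) := by
  obtain ⟨h, rfl⟩ : ∃ h', h = h' + 1 := ⟨h - 1, by omega⟩
  simp only [Nat.add_sub_cancel, ← add_assoc] at ha ⊢
  set ρ := ∑ i, a i % r with hρ
  -- The remainders already supply degree `ρ`, so the quotient must give up only `d` units, each
  -- worth `r`. Truncation gives `d = 0` when the remainders suffice. Here `h` is the original value
  -- minus one.
  set d := h - ρ / r with hd
  have hρlt : ρ < r * (ρ / r + 1) := Nat.lt_mul_div_succ ρ hr
  have hρle : r * (ρ / r) ≤ ρ := Nat.mul_div_le ρ r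
  have hq : ∀ S : Finset (Fin n), S.card = h + 1 → m + d ≤ ∑ i ∈ S, a i / r := by
    intro S hS
    have h1 : ∑ i ∈ S, a i = r * ∑ i ∈ S, a i / r + ∑ i ∈ S, a i % r := by
      rw [Finset.mul_sum, ← Finset.sum_add_distrib]
      exact Finset.sum_congr rfl fun i _ => (Nat.div_add_mod _ _).symm
    -- Two bounds on the remainders over `S`: this one settles `ρ / r < h`, and `h3`, from each
    -- remainder being at most `r - 1`, settles `d = 0`.
    have h2 : ∑ i ∈ S, a i % r ≤ ρ := Finset.sum_le_sum_of_subset (Finset.subset_univ S)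
    have h3 : ∑ i ∈ S, a i % r + (h + 1) ≤ (h + 1) * r := by
      have : ∑ i ∈ S, (a i % r + 1) ≤ S.card • r :=
        Finset.sum_le_card_nsmul _ _ _ fun i _ => Nat.mod_lt _ hr
      simpa [Finset.sum_add_distrib, hS] using this
    have h4 := ha S hS
    by_contra! hlt
    have h5 : r * (∑ i ∈ S, a i / r + 1) ≤ r * (m + d) := Nat.mul_le_mul_left r hlt
    rcases le_or_gt h (ρ / r) with hk | hk
    · have : d = 0 := by omega
      rw [this] at h5
      nlinarith
    · have : d + ρ / r = h := by omega
      rw [← this] at h4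
      nlinarith
  obtain ⟨S₀, -, hS₀⟩ := Finset.exists_subset_card_eq (s := (Finset.univ : Finset (Fin n)))
    (n := h + 1) (by simpa using hn)
  obtain ⟨b, hb, hsum⟩ := exists_le_sum_add_eq (q := fun i => a i / r) (d := d)
    ((Nat.le_add_left d m).trans ((hq S₀ hS₀).trans
      (Finset.sum_le_sum_of_subset (Finset.subset_univ S₀))))
  have hba : ∀ i, r * b i ≤ a i := fun i =>
    (Nat.mul_le_mul_left r (hb i)).trans (Nat.mul_div_le _ _)
  refine ⟨b, hba, fun S hS => ?_, ?_⟩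
  · have h1 := hq S hS
    have h2 : ∑ i ∈ Sᶜ, b i ≤ ∑ i ∈ Sᶜ, a i / r := Finset.sum_le_sum fun i _ => hb i
    rw [← Finset.sum_add_sum_compl S, ← Finset.sum_add_sum_compl S (fun i => a i / r)] at hsum
    omega
  · have h1 : ∑ i, a i = r * ∑ i, a i / r + ρ := by
      rw [Finset.mul_sum, ← Finset.sum_add_distrib]
      exact Finset.sum_congr rfl fun i _ => (Nat.div_add_mod _ _).symm
    have h2 : ∑ i, (a i - r * b i) + r * ∑ i, b i = ∑ i, a i := by
      rw [Finset.mul_sum, ← Finset.sum_add_distrib]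
      exact Finset.sum_congr rfl fun i _ => Nat.sub_add_cancel (hba i)
    have h3 : r * h ≤ r * (d + ρ / r) := Nat.mul_le_mul_left r (by omega)
    rw [← hsum] at h1
    nlinarith

theorem monomialSymbolicPower_le_mul_pow {h : ℕ} (hh : 1 ≤ h) (hn : h ≤ n) {F : Fin n → R}
    {J : Ideal R} (hJ : ∀ i, F i ∈ J) (m r : ℕ) :
    monomialSymbolicPower h F (r * (m + h - 1)) ≤
      J ^ (r * (h - 1)) * monomialSymbolicPower h F m ^ r := by
  rcases Nat.eq_zero_or_pos r with rfl | hr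
  · simp
  rw [monomialSymbolicPower, Ideal.span_le]
  rintro _ ⟨a, ha, rfl⟩
  obtain ⟨b, hba, hb, hdeg⟩ := exists_smul_le_of_le_sum hh hn hr ha
  have : ∏ i, F i ^ a i = (∏ i, F i ^ (a i - r * b i)) * (∏ i, F i ^ b i) ^ r := by
    rw [← Finset.prod_pow, ← Finset.prod_mul_distrib]
    refine Finset.prod_congr rfl fun i _ => ?_
    rw [← pow_mul, ← pow_add, mul_comm (b i), Nat.sub_add_cancel (hba i)]
  rw [this]
  refine Ideal.mul_mem_mul (Ideal.pow_le_pow_right hdeg ?_)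
    (Ideal.pow_mem_pow (show _ ∈ monomialSymbolicPower h F m from
      Ideal.subset_span ⟨b, hb, rfl⟩) r)
  rw [← Finset.prod_pow_eq_pow_sum]
  exact Ideal.prod_mem_prod fun i _ => Ideal.pow_mem_pow (hJ i) _

end StarIdeals

/-! ### Star configurations and initial degrees. -/

section StarConfigurations

open MvPolynomial

theorem MvPolynomial.IsHomogeneous.mem_pow_idealOfVars {σ k : Type*} [CommSemiring k]
    {f : MvPolynomial σ k} {d : ℕ} (hf : f.IsHomogeneous d) : f ∈ idealOfVars σ k ^ d := by
  rw [mem_pow_idealOfVars_iff]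
  intro x hx
  exact (hf.degree_eq_sum_deg_support hx).le

theorem MvPolynomial.IsHomogeneous.le_of_mem_pow_idealOfVars {σ k : Type*} [CommSemiring k]
    {f : MvPolynomial σ k} {d D : ℕ} (hf : f.IsHomogeneous d) (hf0 : f ≠ 0)
    (hD : f ∈ idealOfVars σ k ^ D) : D ≤ d := by
  obtain ⟨x, hx⟩ := support_nonempty.mpr hf0
  rw [mem_pow_idealOfVars_iff] at hD
  rw [hf.degree_eq_sum_deg_support hx]
  exact hD x hx

namespace IsStarConfiguration

variable {k : Type*} [Field k] {N n h : ℕ} {F : Fin n → MvPolynomial (Fin (N + 1)) k}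
  (hF : IsStarConfiguration h F)

include hF

theorem regularModSubsets : RegularModSubsets h F := by
  intro U hU q hq x hx
  -- Enumerating `q` last makes the final regularity condition the one modulo `U`; this uses `h + 1`
  -- forms.
  have hreg := hF.isCompleteIntersection (insert q U)
    ((Finset.card_insert_le q U).trans (by omega)) (U.toList ++ [q])
    (by
      rw [List.nodup_append]
      refine ⟨U.nodup_toList, List.nodup_singleton q, ?_⟩
      rintro a ha b hb rfl
      rw [List.mem_singleton] at hb
      exact hq (hb ▸ Finset.mem_toList.mp ha))
    (by intro i; simp [or_comm])
  have h1 := hreg.toIsWeaklyRegular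
  rw [List.map_append, RingTheory.Sequence.isWeaklyRegular_append_iff, List.map_singleton,
    RingTheory.Sequence.isWeaklyRegular_singleton_iff] at h1
  have hI : (Ideal.ofList (U.toList.map F) • ⊤ : Ideal (MvPolynomial (Fin (N + 1)) k)) =
      Ideal.span (F '' U) := by
    rw [smul_eq_mul, Ideal.mul_top, Ideal.ofList]
    congr 1
    ext y
    simp
  rw [← hI] at hx ⊢
  rw [← Submodule.Quotient.mk_eq_zero] at hx ⊢
  apply h1.2
  dsimp only
  rw [smul_zero, ← Submodule.Quotient.mk_smul]
  exact hx

theorem ne_zero (i : Fin n) : F i ≠ 0 := by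
  intro h0
  have := hF.regularModSubsets ∅ (by simp) i (by simp) 1 (by simp [h0])
  simp at this

theorem mem_idealOfVars (i : Fin n) : F i ∈ idealOfVars (Fin (N + 1)) k := by
  obtain ⟨d, hd⟩ := hF.isHomogeneous i
  rcases Nat.eq_zero_or_pos d with rfl | hpos
  -- A nonzero constant is a unit, against the properness included in regularity.
  · exfalso
    have hC := totalDegree_eq_zero_iff_eq_C.mp ((totalDegree_zero_iff_isHomogeneous (p := F i)).mpr hd)
    have hreg := hF.isCompleteIntersection {i} (by simp) [i] (by simp) (by simp)
    refine hreg.top_ne_smul ?_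
    have hu : IsUnit (F i) := by
      rw [hC]
      refine (IsUnit.mk0 _ fun h0 => hF.ne_zero i ?_).map C
      rw [hC, h0, C_0]
    rw [smul_eq_mul, Ideal.mul_top, List.map_singleton, Ideal.ofList_singleton,
      Ideal.span_singleton_eq_top.mpr hu]
  · have := Ideal.pow_le_pow_right hpos hd.mem_pow_idealOfVars
    rwa [pow_one] at this

theorem symbolicPower_eq (s : ℕ) :
    symbolicPower (starConfigurationIdeal h F) s = monomialSymbolicPower h F s :=
  le_antisymm (hF.regularModSubsets.symbolicPower_le_monomialSymbolicPower hF.one_le s)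
    (hF.regularModSubsets.monomialSymbolicPower_le_symbolicPower s)

/-- The monomial generators are nonzero and homogeneous, so each has degree at least the initial
degree. -/
theorem symbolicPower_le_pow_idealOfVars (m : ℕ) :
    symbolicPower (starConfigurationIdeal h F) m ≤ idealOfVars (Fin (N + 1)) k ^
      initialDegree (symbolicPower (starConfigurationIdeal h F) m) := by
  choose d hd using hF.isHomogeneous
  rw [hF.symbolicPower_eq, monomialSymbolicPower, Ideal.span_le]
  rintro _ ⟨a, ha, rfl⟩
  have hhom : (∏ i, F i ^ a i).IsHomogeneous (∑ i, d i * a i) :=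
    IsHomogeneous.prod _ _ _ fun i _ => (hd i).pow (a i)
  have hmem : ∏ i, F i ^ a i ∈ monomialSymbolicPower h F m := Ideal.subset_span ⟨a, ha, rfl⟩
  have hne : ∏ i, F i ^ a i ≠ 0 :=
    Finset.prod_ne_zero_iff.mpr fun i _ => pow_ne_zero _ (hF.ne_zero i)
  have hle : initialDegree (monomialSymbolicPower h F m) ≤ ∑ i, d i * a i :=
    Nat.sInf_le ⟨_, hmem, hne, hhom⟩
  exact Ideal.pow_le_pow_right hle hhom.mem_pow_idealOfVars

theorem exists_mem_symbolicPower_isHomogeneous (t : ℕ) :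
    ∃ f ∈ symbolicPower (starConfigurationIdeal h F) t, f ≠ 0 ∧
      f.IsHomogeneous (initialDegree (symbolicPower (starConfigurationIdeal h F) t)) := by
  choose d hd using hF.isHomogeneous
  -- The witness `∏ F i ^ t` has `h`-fold sums `h * t ≥ t`, so the infimum is attained and is not
  -- the default value.
  refine Nat.sInf_mem (s := {d : ℕ | ∃ f ∈ symbolicPower (starConfigurationIdeal h F) t,
    f ≠ 0 ∧ f.IsHomogeneous d}) ⟨∑ i, d i * t, ∏ i, F i ^ t, ?_, ?_, ?_⟩
  · rw [hF.symbolicPower_eq]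
    refine Ideal.subset_span ⟨fun _ => t, fun S hS => ?_, rfl⟩
    rw [Finset.sum_const, hS, smul_eq_mul]
    exact Nat.le_mul_of_pos_left t hF.one_le
  · exact Finset.prod_ne_zero_iff.mpr fun i _ => pow_ne_zero _ (hF.ne_zero i)
  · exact IsHomogeneous.prod _ _ _ fun i _ => (hd i).pow t

theorem symbolicPower_le_mul_pow (m r : ℕ) :
    symbolicPower (starConfigurationIdeal h F) (r * (m + h - 1)) ≤
      idealOfVars (Fin (N + 1)) k ^ (r * (h - 1)) *
        symbolicPower (starConfigurationIdeal h F) m ^ r := by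
  rw [hF.symbolicPower_eq, hF.symbolicPower_eq]
  exact monomialSymbolicPower_le_mul_pow hF.one_le hF.le_card hF.mem_idealOfVars m r

/-- Raising `f` in `I^(t)` to the power `m + h - 1` lands in `I^(t (m + h - 1))`, where the
containment applies with `r = t`. -/
theorem mul_initialDegree_le (m t : ℕ) :
    t * (h - 1) + initialDegree (symbolicPower (starConfigurationIdeal h F) m) * t ≤
      initialDegree (symbolicPower (starConfigurationIdeal h F) t) * (m + h - 1) := by
  obtain ⟨f, hf, hf0, hfd⟩ := hF.exists_mem_symbolicPower_isHomogeneous t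
  have hmem : f ^ (m + h - 1) ∈ idealOfVars (Fin (N + 1)) k ^ (t * (h - 1) +
      initialDegree (symbolicPower (starConfigurationIdeal h F) m) * t) := by
    rw [pow_add (idealOfVars (Fin (N + 1)) k), pow_mul (idealOfVars (Fin (N + 1)) k) _ t]
    exact Ideal.mul_mono_right (Ideal.pow_right_mono (hF.symbolicPower_le_pow_idealOfVars m) t)
      (hF.symbolicPower_le_mul_pow m t (pow_mem_symbolicPower hf (m + h - 1)))
  exact (hfd.pow (m + h - 1)).le_of_mem_pow_idealOfVars (pow_ne_zero _ hf0) hmem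

end IsStarConfiguration

end StarConfigurations

theorem corollary3p6 {k : Type*} [Field k] {N n h : ℕ}
    (F : Fin n → MvPolynomial (Fin (N + 1)) k) (hF : IsStarConfiguration h F) :
    (∀ m r : ℕ,
      symbolicPower (starConfigurationIdeal h F) (r * (m + h - 1)) ≤
        MvPolynomial.idealOfVars (Fin (N + 1)) k ^ (r * (h - 1)) *
          symbolicPower (starConfigurationIdeal h F) m ^ r) ∧
    (∀ m t : ℕ, 1 ≤ m → 1 ≤ t →
      ((initialDegree (symbolicPower (starConfigurationIdeal h F) m) : ℝ) + (h : ℝ) - 1) /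
          ((m : ℝ) + (h : ℝ) - 1) ≤
        (initialDegree (symbolicPower (starConfigurationIdeal h F) t) : ℝ) / (t : ℝ)) := by
  refine ⟨hF.symbolicPower_le_mul_pow, fun m t hm ht => ?_⟩
  have hle := hF.mul_initialDegree_le m t
  -- Removes the truncated subtractions before casting to the reals.
  obtain ⟨h', rfl⟩ : ∃ h', h = h' + 1 := ⟨h - 1, by have := hF.one_le; omega⟩
  simp only [Nat.add_sub_cancel, ← add_assoc] at hle
  have hm' : (1 : ℝ) ≤ m := by exact_mod_cast hm
  have ht' : (1 : ℝ) ≤ t := by exact_mod_cast ht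
  have hh' : (0 : ℝ) ≤ h' := Nat.cast_nonneg h'
  have hle' := (Nat.cast_le (α := ℝ)).mpr hle
  push_cast at hle' ⊢
  rw [div_le_div_iff₀ (by linarith) (by linarith)]
  linarith
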